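/- Let $A$ be a finite alphabet. A \emph{quotienting lattice of regular languages} is a set $\mathcal C$ of regular languages over $A$ that contains $\emptyset$ and $A^*$, is closed under (binary) union and intersection, and contains $u^{-1}K=\{w\mid uw\in K\}$ and $Ku^{-1}=\{w\mid wu\in K\}$ for all $K\in\mathcal C$ and $u\in A^*$. Its \emph{polynomial closure} $\mathrm{Pol}(\mathcal C)$ is the smallest class of languages over $A$ that contains $\mathcal C$ and is closed under union, $(H,K)\mapsto H\cup K$, and marked concatenation, $(H,K)\mapsto HaK$ for $a\in A$. For a regular language $L\subseteq A^*$, let $\equiv_L$ be the syntactic congruence on $A^*$ ($u\equiv_L v$ iff $xuy\in L\Leftrightarrow xvy\in L$ for all $x,y\in A^*$), let $\alpha_L\colon A^*\to M_L=A^*/{\equiv_L}$ be the syntactic morphism onto the (finite) syntactic monoid, and let $\leq_L$ be the syntactic order on $M_L$: $s\leq_L t$ iff $xsy\in\alpha_L(L)\Rightarrow xty\in\alpha_L(L)$ for all $x,y\in M_L$. Let $\omega\geq 1$ be the least positive integer such that $s^\omega$ is idempotent for every $s\in M_L$. A pair $(s,t)\in M_L^2$ is a \emph{$\mathcal C$-pair}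 if $\alpha_L^{-1}(s)$ is not $\mathcal C$-separable from $\alpha_L^{-1}(t)$, that is, if there is no $K\in\mathcal C$ with $\alpha_L^{-1}(s)\subseteq K$ and $K\cap\alpha_L^{-1}(t)=\emptyset$. \textbf{Theorem.} Let $\mathcal C$ be a quotienting lattice of regular languages over $A$ and let $L\subseteq A^*$ be a regular language. The following three properties are equivalent: \begin{enumerate} \item $L\in\mathrm{Pol}(\mathcal C)$; \item $s^{\omega+1}\leq_L s^\omega t s^\omega$ for every $\mathcal C$-pair $(s,t)\in M_L^2$; \item $e\leq_L ete$ for every $\mathcal C$-pair $(e,t)\in M_L^2$ with $e$ idempotent. \end{enumerate} -/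

import Mathlib

namespace PolClosure

variable {A : Type*}

/-- The right quotient `L u⁻¹ = {w | w u ∈ L}`. The left quotient `u⁻¹ L` is
`Language.leftQuotient L u`. -/
def rightQuotient (L : Language A) (u : List A) : Language A := {w | w ++ u ∈ L}

/-- A quotienting lattice of regular languages over the alphabet `A`. -/
structure IsRegularQuotientingLattice (C : Set (Language A)) : Prop where
  isRegular : ∀ K ∈ C, K.IsRegular
  empty_mem : (⊥ : Language A) ∈ C
  univ_mem : (⊤ : Language A) ∈ C
  union_mem : ∀ K ∈ C, ∀ L ∈ C, K ⊔ L ∈ C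
  inter_mem : ∀ K ∈ C, ∀ L ∈ C, K ⊓ L ∈ C
  leftQuotient_mem : ∀ L ∈ C, ∀ u : List A, L.leftQuotient u ∈ C
  rightQuotient_mem : ∀ L ∈ C, ∀ u : List A, rightQuotient L u ∈ C

/-- The polynomial closure: the smallest class that contains `C` and is closed under union and
under the marked concatenations `H a K`, `a` a letter. -/
inductive Pol (C : Set (Language A)) : Set (Language A)
  | base (L : Language A) : L ∈ C → Pol C L
  | union (H K : Language A) : Pol C H → Pol C K → Pol C (H ⊔ K)
  | marked (H K : Language A) (a : A) : Pol C H → Pol C K →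
      Pol C (H * ({[a]} : Language A) * K)

/-- `K` separates `L₁` from `L₂`. -/
def Separates (K L₁ L₂ : Language A) : Prop := L₁ ≤ K ∧ L₂ ⊓ K = ⊥

/-- `L₁` is `C`-separable from `L₂` (not a symmetric notion). -/
def Separable (C : Set (Language A)) (L₁ L₂ : Language A) : Prop :=
  ∃ K ∈ C, Separates K L₁ L₂

/-- The language `α⁻¹(s)`. -/
def fiber {M : Type*} [Monoid M] (α : FreeMonoid A →* M) (s : M) : Language A :=
  {w | α (FreeMonoid.ofList w) = s}

/-- `(s, t)` is a `C`-pair for the morphism `α`. -/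
def IsPair (C : Set (Language A)) {M : Type*} [Monoid M] (α : FreeMonoid A →* M) (s t : M) :
    Prop :=
  ¬ Separable C (fiber α s) (fiber α t)

/-- The syntactic congruence of `L`. -/
def syntacticCon (L : Language A) : Con (FreeMonoid A) where
  r u v := ∀ x y : FreeMonoid A,
    FreeMonoid.toList (x * u * y) ∈ L ↔ FreeMonoid.toList (x * v * y) ∈ L
  iseqv :=
    ⟨fun _ _ _ => Iff.rfl, fun h x y => (h x y).symm, fun h h' x y => (h x y).trans (h' x y)⟩
  mul' := by
    intro u v u' v' h h' x y
    have h₁ := h x (u' * y)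
    have h₂ := h' (x * v) y
    simp only [mul_assoc] at h₁ h₂ ⊢
    exact h₁.trans h₂

/-- The syntactic monoid `M_L`. -/
def SyntacticMonoid (L : Language A) : Type _ := (syntacticCon L).Quotient

instance (L : Language A) : Monoid (SyntacticMonoid L) :=
  inferInstanceAs (Monoid (syntacticCon L).Quotient)

/-- The syntactic morphism `α_L`, which maps a word to its class. -/
def syntacticMorphism (L : Language A) : FreeMonoid A →* SyntacticMonoid L :=
  (syntacticCon L).mk'

/-- The set `α_L(L)`. -/
def syntacticImage (L : Language A) : Set (SyntacticMonoid L) :=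
  {s | ∃ w ∈ L, syntacticMorphism L (FreeMonoid.ofList w) = s}

theorem syntacticMorphism_surjective (L : Language A) :
    Function.Surjective (syntacticMorphism L) :=
  Con.mk'_surjective

theorem syntacticMorphism_eq_iff (L : Language A) (u v : FreeMonoid A) :
    syntacticMorphism L u = syntacticMorphism L v ↔ syntacticCon L u v :=
  Con.eq _

theorem mem_syntacticImage_iff (L : Language A) (u : FreeMonoid A) :
    syntacticMorphism L u ∈ syntacticImage L ↔ FreeMonoid.toList u ∈ L := by
  constructor
  · rintro ⟨w, hw, h⟩
    have := ((syntacticMorphism_eq_iff L _ _).1 h) 1 1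
    simp only [one_mul, mul_one] at this
    exact this.1 hw
  · intro h
    exact ⟨FreeMonoid.toList u, h, rfl⟩

/-- The syntactic order `≤_L`. -/
instance (L : Language A) : PartialOrder (SyntacticMonoid L) where
  le s t := ∀ x y : SyntacticMonoid L,
    x * s * y ∈ syntacticImage L → x * t * y ∈ syntacticImage L
  le_refl _ _ _ h := h
  le_trans _ _ _ h h' x y hx := h' x y (h x y hx)
  le_antisymm s t h h' := by
    obtain ⟨u, rfl⟩ := syntacticMorphism_surjective L s
    obtain ⟨v, rfl⟩ := syntacticMorphism_surjective L t
    rw [syntacticMorphism_eq_iff]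
    intro x y
    have h₁ := h (syntacticMorphism L x) (syntacticMorphism L y)
    have h₂ := h' (syntacticMorphism L x) (syntacticMorphism L y)
    simp only [← map_mul, mem_syntacticImage_iff] at h₁ h₂
    exact ⟨h₁, h₂⟩

/-- The exponent `ω(M)`: the least positive integer `n` such that `s ^ n` is idempotent for every
`s` in `M`. It exists when `M` is finite, see `omega_spec`. -/
noncomputable def omega (M : Type*) [Monoid M] : ℕ :=
  sInf {n : ℕ | 0 < n ∧ ∀ s : M, IsIdempotentElem (s ^ n)}

theorem omega_spec (M : Type*) [Monoid M] [Finite M] :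
    0 < omega M ∧ ∀ s : M, IsIdempotentElem (s ^ omega M) := by
  have key : ∀ s : M, ∃ n : ℕ, 0 < n ∧ IsIdempotentElem (s ^ n) := by
    intro s
    obtain ⟨i, j, hij, h⟩ := Finite.exists_ne_map_eq_of_infinite (fun n : ℕ => s ^ n)
    wlog hlt : i < j generalizing i j
    · exact this j i hij.symm h.symm (by omega)
    obtain ⟨p, rfl⟩ : ∃ p, j = i + p := ⟨j - i, by omega⟩
    have hp : 0 < p := by omega
    have step : ∀ q k : ℕ, s ^ (i + k + q * p) = s ^ (i + k) := by
      intro q k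
      induction q with
      | zero => simp
      | succ q ih =>
        have : i + k + (q + 1) * p = (i + p) + (k + q * p) := by ring
        rw [this, pow_add]
        have h' : s ^ (i + p) = s ^ i := h.symm
        rw [h', ← pow_add, ← ih]
        congr 1
        ring
    refine ⟨(i + 1) * p, by positivity, ?_⟩
    have hle : i ≤ (i + 1) * p := by nlinarith
    obtain ⟨k, hk⟩ := Nat.exists_eq_add_of_le hle
    have := step (i + 1) k
    rw [← hk] at this
    rw [IsIdempotentElem, ← pow_add, this]
  choose f hf hf' using key
  have := Fintype.ofFinite M
  refine Nat.sInf_mem (s := {n : ℕ | 0 < n ∧ ∀ s : M, IsIdempotentElem (s ^ n)})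
    ⟨∏ s, f s, Finset.prod_pos fun s _ => hf s, fun s => ?_⟩
  obtain ⟨c, hc⟩ := Finset.dvd_prod_of_mem f (Finset.mem_univ s)
  rw [hc, pow_mul]
  exact (hf' s).pow c

/-- The syntactic monoid of a regular language is finite. -/
theorem finite_syntacticMonoid {L : Language A} (hL : L.IsRegular) :
    Finite (SyntacticMonoid L) := by
  obtain ⟨σ, _, D, rfl⟩ := hL
  choose g hg using syntacticMorphism_surjective D.accepts
  refine Finite.of_injective
    (fun s => fun q : σ => D.evalFrom q (FreeMonoid.toList (g s))) ?_
  intro s t h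
  rw [← hg s, ← hg t, syntacticMorphism_eq_iff]
  intro x y
  simp only [FreeMonoid.toList_mul, DFA.mem_accepts, DFA.eval, DFA.evalFrom_of_append]
  have := congrFun h (D.evalFrom D.start (FreeMonoid.toList x))
  simp only at this
  rw [this]

end PolClosure

/-! Membership gives the inequality for all `C`-pairs by pumping (`Pol.exists_pumps`). A language of
`Pol C` is built from finitely many languages of `C`; let `D` be the finite set of their quotients.
In a word of the language, a long power of `u` may be replaced by `u ^ (p * a) * v * u ^ (p * b)`
whenever `v` lies in every language of `D` containing `u`. A `C`-pair provides such `u`, `v` above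
it for every finite `D` (`IsPair.exists_words`). The inequality for idempotents is a special case.

The converse is a factorization forest argument. By `FactorizationClosed.univ`, finitely many
unions, products and sandwiches `x * m * y` (`x`, `m`, `y` of the same idempotent image `e`, `m`
arbitrary) build all words from letters and the empty word. Each operation preserves the existence
of a finite cover by languages of `Pol C` lying above the words they cover. In a sandwich, `m` is
covered by `upper D m`: its words have images `t` with `(e, t)` a `C`-pair, and `e ≤ e * t * e`
absorbs them. As `L` is upward closed, it is a finite union of cover languages. -/

open Pointwise

namespace PolClosure

/-! ### Ideal sizes and stability in finite monoids. -/

section Ideals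

variable {M : Type*} [Monoid M]

/-- The number of elements of the two-sided ideal generated by `s`. -/
noncomputable def idealCard (s : M) : ℕ := {z : M | ∃ x y, z = x * s * y}.ncard

theorem idealCard_le_card [Finite M] (s : M) : idealCard s ≤ Nat.card M :=
  Set.ncard_le_card _

theorem idealCard_mul_mul_le [Finite M] (x s y : M) : idealCard (x * s * y) ≤ idealCard s := by
  refine Set.ncard_le_ncard ?_ (Set.toFinite _)
  rintro _ ⟨a, b, rfl⟩
  exact ⟨a * x, y * b, by simp only [mul_assoc]⟩

theorem idealCard_mul_le_left [Finite M] (s t : M) : idealCard (s * t) ≤ idealCard s := by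
  simpa using idealCard_mul_mul_le 1 s t

theorem idealCard_mul_le_right [Finite M] (s t : M) : idealCard (s * t) ≤ idealCard t := by
  simpa using idealCard_mul_mul_le s t 1

/-- An element of `M x M` which generates an ideal at least as large generates `M x M`. -/
theorem exists_eq_mul_mul_of_idealCard_le [Finite M] {a x b : M}
    (h : idealCard x ≤ idealCard (a * x * b)) : ∃ c d, x = c * (a * x * b) * d := by
  have hsub : {z : M | ∃ c d, z = c * (a * x * b) * d} ⊆ {z : M | ∃ c d, z = c * x * d} := by
    rintro _ ⟨c, d, rfl⟩
    exact ⟨c * a, b * d, by simp only [mul_assoc]⟩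
  have heq := Set.eq_of_subset_of_ncard_le hsub h (Set.toFinite _)
  have hx : x ∈ {z : M | ∃ c d, z = c * x * d} := ⟨1, 1, by simp⟩
  rwa [← heq] at hx

theorem pow_mul_mul_pow_eq {f x b : M} (h : x = f * x * b) (n : ℕ) : x = f ^ n * x * b ^ n := by
  induction n with
  | zero => simp
  | succ n ih =>
    calc x = f ^ n * x * b ^ n := ih
      _ = f ^ n * (f * x * b) * b ^ n := by rw [← h]
      _ = f ^ (n + 1) * x * b ^ (n + 1) := by
        rw [pow_succ f, pow_succ' b]; simp only [mul_assoc]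

/-- Stability of finite monoids, left version. -/
theorem exists_eq_mul_of_idealCard_le [Finite M] {z x : M}
    (h : idealCard x ≤ idealCard (z * x)) : ∃ y, x = y * (z * x) := by
  obtain ⟨a, b, hab⟩ := exists_eq_mul_mul_of_idealCard_le (a := z) (x := x) (b := 1) (by simpa)
  obtain ⟨hpos, hid⟩ := omega_spec M
  set n := omega M
  -- Iterating `x = (a * z) * x * b` up to an idempotent power of `a * z` makes the factor `b`
  -- irrelevant.
  have h1 := pow_mul_mul_pow_eq (f := a * z) (x := x) (b := b)
    (by simpa only [mul_one, mul_assoc] using hab) n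
  have h2 : (a * z) ^ n * x = x := by
    conv_lhs => rw [h1]
    rw [← mul_assoc, ← mul_assoc, (hid (a * z)).eq, ← h1]
  refine ⟨(a * z) ^ (n - 1) * a, ?_⟩
  conv_lhs => rw [← h2, ← Nat.sub_add_cancel hpos, pow_succ]
  simp only [mul_assoc]

/-- Stability of finite monoids, right version. -/
theorem exists_eq_mul_of_idealCard_le' [Finite M] {z x : M}
    (h : idealCard x ≤ idealCard (x * z)) : ∃ y, x = x * z * y := by
  obtain ⟨a, b, hab⟩ := exists_eq_mul_mul_of_idealCard_le (a := 1) (x := x) (b := z) (by simpa)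
  obtain ⟨hpos, hid⟩ := omega_spec M
  set n := omega M
  have h1 := pow_mul_mul_pow_eq (f := a) (x := x) (b := z * b)
    (by simpa only [one_mul, mul_assoc] using hab) n
  have h2 : x * (z * b) ^ n = x := by
    conv_lhs => rw [h1]
    rw [mul_assoc, (hid (z * b)).eq, ← h1]
  refine ⟨b * (z * b) ^ (n - 1), ?_⟩
  conv_lhs => rw [← h2, ← Nat.sub_add_cancel hpos, pow_succ']
  simp only [mul_assoc]

/-- Two elements that fix `p` on the right and `q` on the left, and that generate ideals no larger
than those of `p` and `q`, are the same idempotent: the statement is `x * y = x` and `x * y = y`. -/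
theorem mul_eq_of_fix [Finite M] {p q x y : M} (hx : p * x = p) (hy : p * y = p)
    (hx' : x * q = q) (hy' : y * q = q) (hpx : idealCard x ≤ idealCard p)
    (hqy : idealCard y ≤ idealCard q) : x * y = x ∧ x * y = y := by
  -- By stability `x` lies in `M * p` and `y` in `q * M`, so `y` fixes `x` on the right and `x`
  -- fixes `y` on the left.
  obtain ⟨a, ha⟩ := exists_eq_mul_of_idealCard_le (z := p) (x := x) (by rwa [hx])
  obtain ⟨b, hb⟩ := exists_eq_mul_of_idealCard_le' (x := y) (z := q) (by rwa [hy'])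
  rw [hx] at ha
  rw [hy'] at hb
  constructor
  · conv_lhs => rw [ha, mul_assoc, hy, ← ha]
  · conv_lhs => rw [hb, ← mul_assoc, hx', ← hb]

end Ideals

/-! ### Factorization forests. -/

/-- Either a list has no cut with property `P`, or it can be cut at its first and at its last cut
with property `P`. -/
theorem exists_first_last_cut {β : Type*} (bs : List β) (P : List β → List β → Prop) :
    (∀ l r, l ≠ [] → r ≠ [] → bs = l ++ r → ¬ P l r) ∨
    ∃ l m r, l ≠ [] ∧ r ≠ [] ∧ bs = l ++ m ++ r ∧ P l (m ++ r) ∧ P (l ++ m) r ∧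
      (∀ l₁ l₂, l₁ ≠ [] → l₂ ≠ [] → l = l₁ ++ l₂ → ¬ P l₁ (l₂ ++ (m ++ r))) ∧
      (∀ r₁ r₂, r₁ ≠ [] → r₂ ≠ [] → r = r₁ ++ r₂ → ¬ P (l ++ m ++ r₁) r₂) := by
  classical
  by_cases hne : ∃ l r, l ≠ [] ∧ r ≠ [] ∧ bs = l ++ r ∧ P l r
  swap
  · left
    intro l r hl hr h hP
    exact hne ⟨l, r, hl, hr, h, hP⟩
  right
  obtain ⟨l₀, r₀, h₀⟩ := hne
  have hA : ∃ n, ∃ l r : List β, l ≠ [] ∧ r ≠ [] ∧ bs = l ++ r ∧ P l r ∧ l.length = n :=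
    ⟨_, l₀, r₀, h₀.1, h₀.2.1, h₀.2.2.1, h₀.2.2.2, rfl⟩
  have hB : ∃ n, ∃ l r : List β, l ≠ [] ∧ r ≠ [] ∧ bs = l ++ r ∧ P l r ∧ r.length = n :=
    ⟨_, l₀, r₀, h₀.1, h₀.2.1, h₀.2.2.1, h₀.2.2.2, rfl⟩
  obtain ⟨l, r', hl, hr', e1, hP1, hlen1⟩ := Nat.find_spec hA
  obtain ⟨l', r, hl', hr, e2, hP2, hlen2⟩ := Nat.find_spec hB
  have hle : l.length ≤ l'.length := hlen1 ▸ Nat.find_min' hA ⟨l', r, hl', hr, e2, hP2, rfl⟩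
  obtain ⟨m, rfl⟩ : l <+: l' :=
    List.prefix_of_prefix_length_le ⟨r', e1.symm⟩ ⟨r, e2.symm⟩ hle
  have hm : r' = m ++ r := by
    rw [e1, List.append_assoc] at e2
    exact List.append_cancel_left e2
  subst hm
  refine ⟨l, m, r, hl, hr, e2, hP1, hP2, ?_, ?_⟩
  · rintro l₁ l₂ h1 h2 rfl hP
    refine Nat.find_min hA (m := l₁.length) ?_
      ⟨l₁, _, h1, by simp [h2], by simpa using e1, hP, rfl⟩
    rw [← hlen1, List.length_append]
    have := List.length_pos_iff.2 h2
    omega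
  · rintro r₁ r₂ h1 h2 rfl hP
    refine Nat.find_min hB (m := r₂.length) ?_
      ⟨_, r₂, by simp [h1], h2, by simpa using e2, hP, rfl⟩
    rw [← hlen2, List.length_append]
    have := List.length_pos_iff.2 h1
    omega

section Factorization

variable {A M : Type*} [Monoid M] (α : FreeMonoid A →* M)

/-- A family of sets of words that contains the set of letters and the set of the empty word, and
that is closed under subsets, unions, products, and under inserting an arbitrary word of image `e`
between two words of image `e`, for `e` idempotent. -/
structure FactorizationClosed (G : Set (FreeMonoid A) → Prop) : Prop where
  mono : ∀ U V, U ⊆ V → G V → G U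
  union : ∀ U V, G U → G V → G (U ∪ V)
  mul : ∀ U V, G U → G V → G (U * V)
  one : G {1}
  letter : G (Set.range FreeMonoid.of)
  sandwich : ∀ U, G U → G {w | ∃ x ∈ U, ∃ m, ∃ y ∈ U, w = x * m * y ∧
    IsIdempotentElem (α m) ∧ α x = α m ∧ α y = α m}

/-- The products of blocks taken in `W`, each generating an ideal of size `k`, whose inner cuts
have colours in `T` when read in the context `(p, q)`. -/
def blockProducts (W : Set (FreeMonoid A)) (k : ℕ) (T : Set (M × M)) (p q : M) :
    Set (FreeMonoid A) :=
  {w | ∃ bs : List (FreeMonoid A), (∀ b ∈ bs, b ∈ W ∧ idealCard (α b) = k) ∧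
    k ≤ idealCard (p * α bs.prod * q) ∧ bs.prod = w ∧
    ∀ l r, l ≠ [] → r ≠ [] → bs = l ++ r → (p * α l.prod, α r.prod * q) ∈ T}

variable {α} {G : Set (FreeMonoid A) → Prop}

theorem idealCard_prod_le [Finite M] {bs : List (FreeMonoid A)} {k : ℕ} (hne : bs ≠ [])
    (h : ∀ b ∈ bs, idealCard (α b) = k) : idealCard (α bs.prod) ≤ k := by
  cases bs with
  | nil => exact absurd rfl hne
  | cons b bs =>
    rw [List.prod_cons, map_mul, ← h b (by simp)]
    exact idealCard_mul_le_left _ _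

/-- With no colour allowed there is no inner cut, hence at most one block. -/
theorem FactorizationClosed.blockProducts_empty (hG : FactorizationClosed α G)
    {W : Set (FreeMonoid A)} (hW : G W) (k : ℕ) (p q : M) : G (blockProducts α W k ∅ p q) := by
  refine hG.mono _ _ ?_ (hG.union _ _ hG.one hW)
  rintro _ ⟨bs, hbs, -, rfl, hT⟩
  match bs with
  | [] => left; simp
  | [b] => right; simpa using (hbs b (by simp)).1
  | b :: c :: bs => exact absurd (hT [b] (c :: bs) (by simp) (by simp) rfl) (by simp)

/-- Cutting at the first and last cuts of the new colour leaves outer parts that avoid it. The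
middle part is cut again in the same way, now in the context `(p', q')`; three nonempty pieces then
share one idempotent image and form a sandwich. -/
theorem FactorizationClosed.blockProducts_insert [Finite M] (hG : FactorizationClosed α G)
    {W : Set (FreeMonoid A)} {k : ℕ} {T : Set (M × M)} (c : M × M)
    (ih : ∀ p q, G (blockProducts α W k T p q)) (p q : M) :
    G (blockProducts α W k (insert c T) p q) := by
  obtain ⟨p', q'⟩ := c
  set Z := blockProducts α W k T p' q'
  have hGZ : G Z := ih p' q'
  have hmid := hG.union _ _ hG.one (hG.union _ _ hGZ
    (hG.union _ _ (hG.mul _ _ hGZ hGZ) (hG.sandwich _ hGZ)))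
  refine hG.mono _ _ ?_ (hG.union _ _ (ih p q)
    (hG.mul _ _ (hG.mul _ _ (ih p q') hmid) (ih p' q)))
  rintro _ ⟨bs, hbs, hk, rfl, hT⟩
  rcases exists_first_last_cut bs (fun l r => (p * α l.prod, α r.prod * q) = (p', q')) with
    hno | ⟨l, m, r, hl, hr, rfl, h1, h2, hlT, hrT⟩
  · left
    refine ⟨bs, hbs, hk, rfl, fun l r hl hr h => ?_⟩
    exact (hT l r hl hr h).resolve_left (hno l r hl hr h)
  right
  simp only [Prod.mk.injEq, List.prod_append, map_mul] at h1 h2 hlT hrT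
  simp only [List.prod_append, map_mul] at hk hT
  obtain ⟨h1p, h1q⟩ := h1
  obtain ⟨h2p, h2q⟩ := h2
  have hpq : k ≤ idealCard (p' * q') := by
    rw [← h1p, ← h1q]; simpa only [mul_assoc] using hk
  -- The two cuts have the same colour, so the stretch between them fixes `p'` and `q'`.
  have hmp : p' * α m.prod = p' := by rw [← h1p, mul_assoc, h2p, h1p]
  have hmq : α m.prod * q' = q' := by rw [← h2q, ← mul_assoc, h1q, h2q]
  have hkp : k ≤ idealCard p' := hpq.trans (idealCard_mul_le_left _ _)
  have hkq : k ≤ idealCard q' := hpq.trans (idealCard_mul_le_right _ _)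
  rw [List.prod_append, List.prod_append]
  refine Set.mul_mem_mul (Set.mul_mem_mul ?_ ?_) ?_
  · refine ⟨l, fun b hb => hbs b (by simp [hb]), ?_, rfl, ?_⟩
    · rw [h1p]; exact hpq
    · intro l₁ l₂ hl₁ hl₂ h
      -- What follows `l` acts on `q` to give `q'`, so cuts of `l` keep their colour in the context
      -- `(p, q')`.
      have hh := hT l₁ (l₂ ++ (m ++ r)) hl₁ (by simp [hl₂]) (by simp [h])
      have hn := hlT l₁ l₂ hl₁ hl₂ h
      simp only [List.prod_append, map_mul, mul_assoc] at hh hn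
      simp only [mul_assoc] at h1q
      rw [h1q] at hh hn
      exact hh.resolve_left (by simpa using hn)
  · have hbm : ∀ b ∈ m, b ∈ W ∧ idealCard (α b) = k := fun b hb => hbs b (by simp [hb])
    have hmT : ∀ l₁ l₂, l₁ ≠ [] → l₂ ≠ [] → m = l₁ ++ l₂ →
        (p' * α l₁.prod, α l₂.prod * q') ∈ insert (p', q') T := by
      intro l₁ l₂ hl₁ hl₂ h
      have hh := hT (l ++ l₁) (l₂ ++ r) (by simp [hl]) (by simp [hr]) (by simp [h])
      simp only [List.prod_append, map_mul, mul_assoc] at hh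
      rw [h2q, ← mul_assoc, h1p] at hh
      exact hh
    clear hlT hrT hT hbs hk
    rcases exists_first_last_cut m
      (fun l r => (p' * α l.prod, α r.prod * q') = (p', q')) with
      hno | ⟨x, n, y, hx, hy, rfl, g1, g2, hxT, hyT⟩
    · right; left
      refine ⟨m, hbm, ?_, rfl, fun l r hl hr h => ?_⟩
      · rw [hmp]; exact hpq
      · exact (hmT l r hl hr h).resolve_left (hno l r hl hr h)
    simp only [Prod.mk.injEq, List.prod_append, map_mul] at g1 g2 hxT hyT hmp hmq
    obtain ⟨g1p, g1q⟩ := g1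
    obtain ⟨g2p, g2q⟩ := g2
    have hnp : p' * α n.prod = p' := by
      conv_lhs => rw [← g1p, mul_assoc, g2p]
    have hnq : α n.prod * q' = q' := by
      conv_lhs => rw [← g2q, ← mul_assoc, g1q]
    have hxq : α x.prod * q' = q' := by
      conv_lhs => rw [← g1q, ← mul_assoc, ← mul_assoc, hmq]
    have hyp : p' * α y.prod = p' := by
      conv_lhs => rw [← g2p, mul_assoc, hmp]
    have hxZ : x.prod ∈ Z := by
      refine ⟨x, fun b hb => hbm b (by simp [hb]), by rwa [g1p], rfl, ?_⟩
      intro l₁ l₂ hl₁ hl₂ h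
      have hh := hmT l₁ (l₂ ++ (n ++ y)) hl₁ (by simp [hl₂]) (by simp [h])
      have hn := hxT l₁ l₂ hl₁ hl₂ h
      simp only [List.prod_append, map_mul, mul_assoc] at hh hn
      simp only [mul_assoc] at g1q
      rw [g1q] at hh hn
      exact hh.resolve_left (by simpa using hn)
    have hyZ : y.prod ∈ Z := by
      refine ⟨y, fun b hb => hbm b (by simp [hb]), by rwa [hyp], rfl, ?_⟩
      intro l₁ l₂ hl₁ hl₂ h
      have hh := hmT (x ++ n ++ l₁) l₂ (by simp [hx]) hl₂ (by simp [h])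
      have hn := hyT l₁ l₂ hl₁ hl₂ h
      simp only [List.prod_append, map_mul, ← mul_assoc] at hh hn
      simp only [← mul_assoc] at g2p
      rw [g2p] at hh hn
      exact hh.resolve_left (by simpa using hn)
    right; right
    -- The ideal of an empty product need not have size at most `k`, so this case uses a plain
    -- product.
    by_cases hn : n = []
    · left
      subst hn
      simpa using Set.mul_mem_mul hxZ hyZ
    right
    have card_le : ∀ z : List (FreeMonoid A), z ≠ [] → (∀ b ∈ z, b ∈ x ++ n ++ y) →
        idealCard (α z.prod) ≤ k := fun z hz hsub =>
      idealCard_prod_le hz fun b hb => (hbm b (hsub b hb)).2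
    have hxk := card_le x hx (by simp +contextual)
    have hnk := card_le n hn (by simp +contextual)
    have hyk := card_le y hy (by simp +contextual)
    have hnn := mul_eq_of_fix hnp hnp hnq hnq (hnk.trans hkp) (hnk.trans hkq)
    have hxn := mul_eq_of_fix g1p hnp hxq hnq (hxk.trans hkp) (hnk.trans hkq)
    have hyn := mul_eq_of_fix hyp hnp g2q hnq (hyk.trans hkp) (hnk.trans hkq)
    refine ⟨x.prod, hxZ, n.prod, y.prod, hyZ, by simp [mul_assoc], hnn.1, ?_, ?_⟩
    · exact hxn.1.symm.trans hxn.2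
    · exact hyn.1.symm.trans hyn.2
  · refine ⟨r, fun b hb => hbs b (by simp [hb]), ?_, rfl, ?_⟩
    · rw [mul_assoc, h2q]; exact hpq
    · intro l₁ l₂ hl₁ hl₂ h
      have hh := hT (l ++ m ++ l₁) l₂ (by simp [hl]) hl₂ (by simp [h])
      have hn := hrT l₁ l₂ hl₁ hl₂ h
      simp only [List.prod_append, map_mul, ← mul_assoc] at hh hn
      simp only [← mul_assoc] at h2p
      rw [h2p] at hh hn
      exact hh.resolve_left (by simpa using hn)

theorem FactorizationClosed.blockProducts [Finite M] (hG : FactorizationClosed α G)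
    {W : Set (FreeMonoid A)} (hW : G W) (k : ℕ) (T : Set (M × M)) (p q : M) :
    G (blockProducts α W k T p q) := by
  induction T, T.toFinite using Set.Finite.induction_on generalizing p q with
  | empty => exact hG.blockProducts_empty hW k p q
  | insert _ _ ih => exact hG.blockProducts_insert _ ih p q

/-- Every word factors as a word of larger ideal (or the empty word) followed by blocks, all of
which generate an ideal of size `k`. -/
theorem exists_block_factorization [Finite M] (k : ℕ) (w : FreeMonoid A)
    (hw : k ≤ idealCard (α w)) :
    ∃ u ∈ ({1} ∪ {u | k < idealCard (α u)} : Set (FreeMonoid A)), ∃ bs : List (FreeMonoid A),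
      w = u * bs.prod ∧ ∀ b ∈ bs, b ∈ Set.range FreeMonoid.of *
        ({1} ∪ {u | k < idealCard (α u)} : Set (FreeMonoid A)) ∧ idealCard (α b) = k := by
  induction w using FreeMonoid.inductionOn' with
  | one => exact ⟨1, Or.inl rfl, [], by simp, by simp⟩
  | of_mul a w ih =>
    obtain ⟨u, hu, bs, rfl, hbs⟩ := ih (hw.trans (by
      rw [map_mul]; exact idealCard_mul_le_right _ _))
    have hk : k ≤ idealCard (α (FreeMonoid.of a * u)) := hw.trans (by
      rw [← mul_assoc, map_mul]; exact idealCard_mul_le_left _ _)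
    rcases hk.lt_or_eq with hlt | heq
    · exact ⟨FreeMonoid.of a * u, Or.inr hlt, bs, by simp [mul_assoc], hbs⟩
    · refine ⟨1, Or.inl rfl, (FreeMonoid.of a * u) :: bs, by simp [mul_assoc], ?_⟩
      rintro b (_ | ⟨_, hb⟩)
      · exact ⟨Set.mul_mem_mul ⟨a, rfl⟩ hu, heq.symm⟩
      · exact hbs b hb

/-- A form of the factorization forest theorem: the set of all words can be built from the empty
word and the letters by finitely many of the operations of `FactorizationClosed`. -/
theorem FactorizationClosed.univ [Finite M] (hG : FactorizationClosed α G) : G Set.univ := by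
  -- Induction downwards on the ideal size, from words of largest ideal to all words.
  have key : ∀ d, G {w | Nat.card M < idealCard (α w) + d} := by
    intro d
    induction d with
    | zero =>
      refine hG.mono _ _ ?_ hG.one
      intro w hw
      exact absurd (idealCard_le_card (α w)) (not_le.2 hw)
    | succ d ih =>
      by_cases hd : Nat.card M < d
      · exact hG.mono _ _ (fun w _ => by simp only [Set.mem_ofPred_eq]; omega) ih
      have hset : {w : FreeMonoid A | Nat.card M < idealCard (α w) + d} =
          {w | Nat.card M - d < idealCard (α w)} := by
        ext w; simp only [Set.mem_ofPred_eq]; omega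
      rw [hset] at ih
      set k := Nat.card M - d with hk
      have hU := hG.union _ _ hG.one ih
      refine hG.mono _ _ ?_ (hG.mul _ _ hU
        (hG.blockProducts (hG.mul _ _ hG.letter hU) k Set.univ 1 1))
      intro w hw
      have hkw : k ≤ idealCard (α w) := by simp only [Set.mem_ofPred_eq] at hw; omega
      obtain ⟨u, hu, bs, rfl, hbs⟩ := exists_block_factorization k w hkw
      refine Set.mul_mem_mul hu ⟨bs, hbs, ?_, rfl, fun _ _ _ _ _ => trivial⟩
      rw [one_mul, mul_one]
      exact hkw.trans (by rw [map_mul]; exact idealCard_mul_le_right _ _)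
  exact hG.mono _ _ (fun w _ => by simp only [Set.mem_ofPred_eq]; omega) (key (Nat.card M + 1))

end Factorization

end PolClosure

namespace PolClosure

variable {A : Type*} {C : Set (Language A)}

/-! ### Finite subsets of the lattice and `C`-pairs. -/

section Lattice

/-- The words that belong to all the languages of `D` which contain `w`. -/
def upper (D : Set (Language A)) (w : List A) : Language A := {v | ∀ K ∈ D, w ∈ K → v ∈ K}

theorem mem_upper {D : Set (Language A)} {w v : List A} :
    v ∈ upper D w ↔ ∀ K ∈ D, w ∈ K → v ∈ K := Iff.rfl

theorem self_mem_upper (D : Set (Language A)) (w : List A) : w ∈ upper D w := fun _ _ h => h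

theorem upper_empty (w : List A) : upper (∅ : Set (Language A)) w = ⊤ := by
  ext v
  exact ⟨fun _ => trivial, fun _ _ h => absurd h (Set.notMem_empty _)⟩

theorem upper_insert_of_mem {D : Set (Language A)} {K : Language A} {w : List A} (h : w ∈ K) :
    upper (insert K D) w = K ⊓ upper D w := by
  ext v
  change _ ↔ v ∈ K ∧ v ∈ upper D w
  simp [mem_upper, h]

theorem upper_insert_of_notMem {D : Set (Language A)} {K : Language A} {w : List A} (h : w ∉ K) :
    upper (insert K D) w = upper D w := by
  ext v
  simp [mem_upper, h]

/-- Adding a language to `D` at most doubles the number of values. This makes covers by the `upper D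
w` finite. -/
theorem finite_range_upper {D : Set (Language A)} (hD : D.Finite) :
    (Set.range (upper D)).Finite := by
  induction D, hD using Set.Finite.induction_on with
  | empty =>
    refine (Set.finite_singleton ⊤).subset ?_
    rintro _ ⟨w, rfl⟩
    exact upper_empty w
  | @insert K D _ _ ih =>
    refine (ih.union (ih.image (K ⊓ ·))).subset ?_
    rintro _ ⟨w, rfl⟩
    by_cases h : w ∈ K
    · exact Or.inr ⟨_, ⟨w, rfl⟩, (upper_insert_of_mem h).symm⟩
    · exact Or.inl ⟨w, (upper_insert_of_notMem h).symm⟩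

theorem IsRegularQuotientingLattice.upper_mem (hC : IsRegularQuotientingLattice C)
    {D : Set (Language A)} (hD : D.Finite) (hDC : D ⊆ C) (w : List A) : upper D w ∈ C := by
  induction D, hD using Set.Finite.induction_on with
  | empty => rw [upper_empty]; exact hC.univ_mem
  | @insert K D _ _ ih =>
    have ih := ih fun _ h => hDC (Or.inr h)
    by_cases h : w ∈ K
    · rw [upper_insert_of_mem h]
      exact hC.inter_mem _ (hDC (Or.inl rfl)) _ ih
    · rwa [upper_insert_of_notMem h]

theorem exists_finite_union {P F : Set (Language A)} (hbot : ⊥ ∈ P)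
    (hsup : ∀ H ∈ P, ∀ K ∈ P, H ⊔ K ∈ P) (hF : F.Finite) (hFP : F ⊆ P) :
    ∃ H ∈ P, ∀ w, w ∈ H ↔ ∃ K ∈ F, w ∈ K := by
  induction F, hF using Set.Finite.induction_on with
  | empty =>
    refine ⟨⊥, hbot, fun w => ?_⟩
    exact ⟨fun h => absurd h id, fun ⟨_, h, _⟩ => absurd h (Set.notMem_empty _)⟩
  | @insert K F _ _ ih =>
    obtain ⟨H, hH, hw⟩ := ih fun _ h => hFP (Or.inr h)
    refine ⟨K ⊔ H, hsup _ (hFP (Or.inl rfl)) _ hH, fun w => ?_⟩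
    change w ∈ K ∨ w ∈ H ↔ _
    simp [hw]

/-- A `C`-pair is witnessed by two words that no language of a given finite subset of `C`
distinguishes. -/
theorem IsPair.exists_words (hC : IsRegularQuotientingLattice C) {M : Type*} [Monoid M]
    {α : FreeMonoid A →* M} {s t : M} (h : IsPair C α s t) {D : Set (Language A)}
    (hD : D.Finite) (hDC : D ⊆ C) :
    ∃ u v : FreeMonoid A, α u = s ∧ α v = t ∧ v.toList ∈ upper D u.toList := by
  by_contra hno
  refine h ?_
  -- Otherwise the finite union of the `upper D w`, `w` in the fiber of `s`, would separate the two
  -- fibers.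
  obtain ⟨H, hH, hw⟩ := exists_finite_union (P := C) (F := upper D '' fiber α s)
    hC.empty_mem hC.union_mem ((finite_range_upper hD).subset (Set.image_subset_range _ _)) (by
      rintro _ ⟨w, -, rfl⟩
      exact hC.upper_mem hD hDC w)
  refine ⟨H, hH, fun w h' => (hw w).2 ⟨_, ⟨w, h', rfl⟩, self_mem_upper D w⟩, ?_⟩
  ext v
  constructor
  · rintro ⟨hv, hvH⟩
    obtain ⟨_, ⟨u, hu, rfl⟩, huv⟩ := (hw v).1 hvH
    exact absurd ⟨FreeMonoid.ofList u, FreeMonoid.ofList v, hu, hv, huv⟩ hno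
  · intro h
    exact absurd h id

end Lattice

/-! ### Closure of `Pol C` under unmarked concatenation. -/

section Concatenation

theorem mem_marked_iff {H K : Language A} {a : A} {w : FreeMonoid A} :
    w.toList ∈ H * ({[a]} : Language A) * K ↔
      ∃ h k : FreeMonoid A, h.toList ∈ H ∧ k.toList ∈ K ∧ h * FreeMonoid.of a * k = w := by
  constructor
  · rintro ⟨_, ⟨h, hh, _, rfl, rfl⟩, k, hk, hw⟩
    exact ⟨FreeMonoid.ofList h, FreeMonoid.ofList k, hh, hk, hw⟩
  · rintro ⟨h, k, hh, hk, rfl⟩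
    exact ⟨_, ⟨_, hh, _, rfl, rfl⟩, _, hk, rfl⟩

theorem sup_mul (H K U : Language A) : (H ⊔ K) * U = H * U ⊔ K * U := add_mul H K U

theorem mul_sup (U H K : Language A) : U * (H ⊔ K) = U * H ⊔ U * K := mul_add U H K

/-- Sort the words of `H` by last letter: `H` is the union of the `(H a⁻¹) a`, and of the empty word
if `H` contains it. The alphabet is finite. -/
theorem Pol.mul_of_mem [Finite A] (hC : IsRegularQuotientingLattice C) {H K : Language A}
    (hH : H ∈ C) (hK : K ∈ C) : H * K ∈ Pol C := by
  obtain ⟨U, hU, hw⟩ := exists_finite_union (P := Pol C)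
    (F := Set.range fun a : A => rightQuotient H [a] * ({[a]} : Language A) * K)
    (.base _ hC.empty_mem) (fun _ h _ h' => .union _ _ h h') (Set.finite_range _) (by
      rintro _ ⟨a, rfl⟩
      exact .marked _ _ _ (.base _ (hC.rightQuotient_mem _ hH _)) (.base _ hK))
  have hmem : ∀ w, w ∈ H * K ↔ ([] ∈ H ∧ w ∈ K) ∨ w ∈ U := by
    intro w
    rw [hw]
    constructor
    · rintro ⟨h, hh, k, hk, rfl⟩
      rcases List.eq_nil_or_concat h with rfl | ⟨h, a, rfl⟩
      · exact Or.inl ⟨hh, hk⟩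
      · rw [List.concat_eq_append] at hh
        exact Or.inr ⟨_, ⟨a, rfl⟩, _, ⟨h, hh, _, rfl, rfl⟩, k, hk,
          by simp⟩
    · rintro (⟨h, hk⟩ | ⟨_, ⟨a, rfl⟩, _, ⟨h, hh, _, rfl, rfl⟩, k, hk, rfl⟩)
      · exact ⟨[], h, w, hk, rfl⟩
      · exact ⟨h ++ [a], hh, k, hk, rfl⟩
  by_cases hnil : [] ∈ H
  · have : H * K = K ⊔ U := by
      ext w
      rw [hmem]
      change _ ↔ w ∈ K ∨ w ∈ U
      simp [hnil]
    rw [this]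
    exact .union _ _ (.base _ hK) hU
  · have : H * K = U := by
      ext w
      simp [hmem, hnil]
    rwa [this]

theorem Pol.mul [Finite A] (hC : IsRegularQuotientingLattice C) {H K : Language A}
    (hH : H ∈ Pol C) (hK : K ∈ Pol C) : H * K ∈ Pol C := by
  induction hK with
  | base K hK =>
    induction hH with
    | base H hH => exact .mul_of_mem hC hH hK
    | union H₁ H₂ _ _ ih₁ ih₂ =>
      rw [sup_mul]
      exact .union _ _ ih₁ ih₂
    | marked H₁ H₂ a h₁ _ _ ih₂ =>
      rw [mul_assoc]
      exact .marked _ _ _ h₁ ih₂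
  | union K₁ K₂ _ _ ih₁ ih₂ =>
    rw [mul_sup]
    exact .union _ _ ih₁ ih₂
  | marked K₁ K₂ a _ h₂ ih₁ _ =>
    rw [← mul_assoc, ← mul_assoc]
    exact .marked _ _ _ ih₁ h₂

end Concatenation

/-! ### From the inequality for idempotents to membership in `Pol C`. -/

section Covers

theorem syntacticMonoid_mul_le_mul {L : Language A} {s s' t t' : SyntacticMonoid L}
    (hs : s ≤ s') (ht : t ≤ t') : s * t ≤ s' * t' := by
  intro x y h
  have h₁ : x * s' * (t * y) ∈ syntacticImage L := hs x (t * y) (by simpa only [mul_assoc] using h)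
  have h₂ : x * s' * t' * y ∈ syntacticImage L := ht (x * s') y (by simpa only [mul_assoc] using h₁)
  simpa only [mul_assoc] using h₂

/-- Finitely many languages of `Pol C` suffice to find, around each word `w` of `W`, a language all
of whose words are above `w` in the syntactic order of `L`. -/
def PolCovers (C : Set (Language A)) (L : Language A) (W : Set (FreeMonoid A)) : Prop :=
  ∃ F : Set (Language A), F.Finite ∧ F ⊆ Pol C ∧ ∀ w ∈ W, ∃ K ∈ F, w.toList ∈ K ∧
    ∀ v : FreeMonoid A, v.toList ∈ K → syntacticMorphism L w ≤ syntacticMorphism L v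

variable {L : Language A}

theorem PolCovers.mem_pol (hC : IsRegularQuotientingLattice C) (h : PolCovers C L Set.univ) :
    L ∈ Pol C := by
  obtain ⟨F, hF, hFP, hw⟩ := h
  obtain ⟨H, hH, hHw⟩ := exists_finite_union (P := Pol C) (F := {K ∈ F | K ≤ L})
    (.base _ hC.empty_mem) (fun _ h _ h' => .union _ _ h h') (hF.subset fun _ h => h.1)
    (fun _ h => hFP h.1)
  convert hH
  ext w
  rw [hHw]
  constructor
  · intro hwL
    obtain ⟨K, hK, hwK, hle⟩ := hw (FreeMonoid.ofList w) trivial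
    refine ⟨K, ⟨hK, fun v hv => ?_⟩, hwK⟩
    have := hle (FreeMonoid.ofList v) hv 1 1
    simp only [one_mul, mul_one, mem_syntacticImage_iff] at this
    exact this hwL
  · rintro ⟨K, ⟨-, hKL⟩, hwK⟩
    exact hKL hwK

/-- There is a finite subset of `C` that separates all the pairs which are not `C`-pairs. -/
theorem exists_finite_isPair (C : Set (Language A)) {M : Type*} [Monoid M] [Finite M]
    (α : FreeMonoid A →* M) : ∃ D : Set (Language A), D.Finite ∧ D ⊆ C ∧
      ∀ u v : FreeMonoid A, v.toList ∈ upper D u.toList → IsPair C α (α u) (α v) := by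
  classical
  have hch : ∀ x : M × M, ∃ K : Language A, Separable C (fiber α x.1) (fiber α x.2) →
      K ∈ C ∧ Separates K (fiber α x.1) (fiber α x.2) := by
    intro x
    by_cases h : Separable C (fiber α x.1) (fiber α x.2)
    · obtain ⟨K, hK⟩ := h
      exact ⟨K, fun _ => hK⟩
    · exact ⟨⊥, fun h' => absurd h' h⟩
  choose f hf using hch
  refine ⟨f '' {x | Separable C (fiber α x.1) (fiber α x.2)}, Set.toFinite _, ?_, ?_⟩
  · rintro _ ⟨x, hx, rfl⟩
    exact (hf x hx).1
  · intro u v huv hsep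
    have hs := (hf (α u, α v) hsep).2
    have hu : u.toList ∈ f (α u, α v) := hs.1 (show α _ = α u from rfl)
    have hv : v.toList ∈ f (α u, α v) := huv _ ⟨_, hsep, rfl⟩ hu
    have hbot : v.toList ∈ (⊥ : Language A) := hs.2 ▸ ⟨(rfl : α v = α v), hv⟩
    exact hbot

theorem PolCovers.mul [Finite A] (hC : IsRegularQuotientingLattice C) {U V : Set (FreeMonoid A)}
    (hU : PolCovers C L U) (hV : PolCovers C L V) : PolCovers C L (U * V) := by
  obtain ⟨F, hF, hFP, hFw⟩ := hU
  obtain ⟨F', hF', hFP', hFw'⟩ := hV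
  refine ⟨Set.image2 (· * ·) F F', hF.image2 _ hF', ?_, ?_⟩
  · rintro _ ⟨H, hH, K, hK, rfl⟩
    exact Pol.mul hC (hFP hH) (hFP' hK)
  · rintro _ ⟨x, hx, y, hy, rfl⟩
    obtain ⟨H, hH, hxH, hxle⟩ := hFw x hx
    obtain ⟨K, hK, hyK, hyle⟩ := hFw' y hy
    refine ⟨H * K, ⟨H, hH, K, hK, rfl⟩, ⟨_, hxH, _, hyK, rfl⟩, ?_⟩
    rintro v ⟨h, hh, k, hk, hv⟩
    obtain rfl : FreeMonoid.ofList h * FreeMonoid.ofList k = v := hv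
    rw [map_mul, map_mul]
    exact syntacticMonoid_mul_le_mul (hxle _ hh) (hyle _ hk)

theorem factorizationClosed_polCovers [Finite A] (hC : IsRegularQuotientingLattice C)
    (hL : L.IsRegular)
    (h : ∀ e t : SyntacticMonoid L, IsIdempotentElem e →
      IsPair C (syntacticMorphism L) e t → e ≤ e * t * e) :
    FactorizationClosed (syntacticMorphism L) (PolCovers C L) := by
  have := finite_syntacticMonoid hL
  set α := syntacticMorphism L
  obtain ⟨D, hD, hDC, hDp⟩ := exists_finite_isPair C α
  have hDP : ∀ w, upper D w ∈ Pol C := fun w => .base _ (hC.upper_mem hD hDC w)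
  -- The inequality for the idempotent `1` says that `1 ≤ α v` for all `v` in `upper D []`.
  have hone : PolCovers C L {1} := by
    refine ⟨{upper D []}, Set.finite_singleton _, ?_, ?_⟩
    · rintro _ rfl
      exact hDP _
    · rintro _ rfl
      refine ⟨_, rfl, self_mem_upper D [], fun v hv => ?_⟩
      have := h 1 (α v) (one_mul 1) (by simpa using hDp 1 v hv)
      simpa [α] using this
  refine ⟨?_, ?_, fun U V hU hV => hU.mul hC hV, hone, ?_, ?_⟩
  · rintro U V hUV ⟨F, hF, hFP, hw⟩
    exact ⟨F, hF, hFP, fun w h => hw w (hUV h)⟩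
  · rintro U V ⟨F, hF, hFP, hw⟩ ⟨F', hF', hFP', hw'⟩
    refine ⟨F ∪ F', hF.union hF', Set.union_subset hFP hFP', ?_⟩
    rintro w (h | h)
    · obtain ⟨K, hK, hh⟩ := hw w h
      exact ⟨K, Or.inl hK, hh⟩
    · obtain ⟨K, hK, hh⟩ := hw' w h
      exact ⟨K, Or.inr hK, hh⟩
  -- Flanking the letter by `upper D []` yields a marked concatenation and only increases the image.
  · refine ⟨Set.range fun a : A => upper D [] * ({[a]} : Language A) * upper D [],
      Set.finite_range _, ?_, ?_⟩
    · rintro _ ⟨a, rfl⟩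
      exact .marked _ _ _ (hDP _) (hDP _)
    · rintro _ ⟨a, rfl⟩
      refine ⟨_, ⟨a, rfl⟩, mem_marked_iff.2 ⟨1, 1, self_mem_upper D [], self_mem_upper D [],
        by simp⟩, fun v hv => ?_⟩
      obtain ⟨x, y, hx, hy, rfl⟩ := mem_marked_iff.1 hv
      have hle : ∀ v : FreeMonoid A, v.toList ∈ upper D [] → 1 ≤ α v := fun v hv => by
        simpa using h 1 (α v) (one_mul 1) (by simpa using hDp 1 v hv)
      have := syntacticMonoid_mul_le_mul
        (syntacticMonoid_mul_le_mul (hle x hx) (le_refl (α (FreeMonoid.of a)))) (hle y hy)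
      simpa only [one_mul, mul_one, ← map_mul] using this
  · rintro U ⟨F, hF, hFP, hw⟩
    refine ⟨Set.image2 (· * ·) (Set.image2 (· * ·) F (Set.range (upper D))) F,
      (hF.image2 _ (finite_range_upper hD)).image2 _ hF, ?_, ?_⟩
    · rintro _ ⟨_, ⟨H, hH, _, ⟨w, rfl⟩, rfl⟩, K, hK, rfl⟩
      exact Pol.mul hC (Pol.mul hC (hFP hH) (hDP w)) (hFP hK)
    · rintro _ ⟨x, hx, m, y, hy, rfl, he, hxm, hym⟩
      obtain ⟨H, hH, hxH, hxle⟩ := hw x hx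
      obtain ⟨K, hK, hyK, hyle⟩ := hw y hy
      refine ⟨_, ⟨_, ⟨H, hH, _, ⟨m.toList, rfl⟩, rfl⟩, K, hK, rfl⟩,
        ⟨_, ⟨_, hxH, _, self_mem_upper D _, rfl⟩, _, hyK, rfl⟩, ?_⟩
      rintro v ⟨_, ⟨x', hx', m', hm', rfl⟩, y', hy', hv⟩
      obtain rfl : FreeMonoid.ofList x' * FreeMonoid.ofList m' * FreeMonoid.ofList y' = v := hv
      have h1 := hxle _ hx'
      have h2 := hyle _ hy'
      have h3 := h _ _ he (hDp m (FreeMonoid.ofList m') hm')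
      rw [map_mul, map_mul, map_mul, map_mul]
      rw [hxm] at h1 ⊢
      rw [hym] at h2 ⊢
      rw [he.eq, he.eq]
      exact h3.trans (syntacticMonoid_mul_le_mul (syntacticMonoid_mul_le_mul h1 le_rfl) h2)

end Covers

end PolClosure

namespace PolClosure

variable {A : Type*} {C : Set (Language A)}

/-! ### Pumping in languages of `Pol C`. -/

theorem mul_of_mul_eq_mul {h k x y : FreeMonoid A} {a : A} (e : h * FreeMonoid.of a * k = x * y) :
    (∃ z, x = h * FreeMonoid.of a * z ∧ k = z * y) ∨
      ∃ z, y = z * FreeMonoid.of a * k ∧ h = x * z := by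
  have e' : h.toList ++ a :: k.toList = x.toList ++ y.toList := by
    have := congrArg FreeMonoid.toList e
    simpa using this
  rcases List.append_eq_append_iff.1 e' with ⟨z, hx, hz⟩ | ⟨z, hh, hy⟩
  · cases z with
    | nil => exact Or.inr ⟨1, hz.symm, by simpa using hx.symm⟩
    | cons b z =>
      obtain rfl := (List.cons.inj hz).1
      refine Or.inl ⟨FreeMonoid.ofList z, ?_, (List.cons.inj hz).2⟩
      rw [mul_assoc]
      exact hx
  · refine Or.inr ⟨FreeMonoid.ofList z, ?_, hh⟩
    rw [mul_assoc]
    exact hy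

/-- The three cases locate the marked letter: in `x`, in `y`, or in one copy of `u`. The induction
moves copies of `u` into `x`. -/
theorem mul_of_mul_eq_mul_pow_mul {h k u : FreeMonoid A} {a : A} (y : FreeMonoid A) (n : ℕ)
    (x : FreeMonoid A) (e : h * FreeMonoid.of a * k = x * u ^ n * y) :
    (∃ z, x = h * FreeMonoid.of a * z ∧ k = z * u ^ n * y) ∨
    (∃ z, y = z * FreeMonoid.of a * k ∧ h = x * u ^ n * z) ∨
    ∃ i j u₁ u₂, i + j + 1 = n ∧ u = u₁ * FreeMonoid.of a * u₂ ∧ h = x * u ^ i * u₁ ∧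
      k = u₂ * u ^ j * y := by
  induction n generalizing x with
  | zero =>
    simp only [pow_zero, mul_one] at e ⊢
    exact (mul_of_mul_eq_mul e).imp_right Or.inl
  | succ n ih =>
    rcases ih (x * u) (by rw [e, pow_succ']; simp only [mul_assoc]) with
      ⟨z, hx, hk⟩ | ⟨z, hy, hh⟩ | ⟨i, j, u₁, u₂, rfl, hu, hh, hk⟩
    · rcases mul_of_mul_eq_mul hx.symm with ⟨z', hx', rfl⟩ | ⟨z', hu, hh⟩
      · exact Or.inl ⟨z', hx', by rw [hk, pow_succ']; simp only [mul_assoc]⟩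
      · exact Or.inr (Or.inr ⟨0, n, z', z, by omega, hu, by simpa using hh, hk⟩)
    · exact Or.inr (Or.inl ⟨z, hy, by rw [hh, pow_succ']; simp only [mul_assoc]⟩)
    · exact Or.inr (Or.inr ⟨i + 1, j, u₁, u₂, by omega, hu,
        by rw [hh, pow_succ']; simp only [mul_assoc], hk⟩)

/-- In words with a large power of `u`, one factor `u` may be replaced by a word `v` that belongs
to all the languages of `D` which contain `u`. -/
def Pumps (D : Set (Language A)) (p n : ℕ) (H : Language A) : Prop :=
  ∀ u v : FreeMonoid A, v.toList ∈ upper D u.toList → ∀ x y : FreeMonoid A,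
    (x * u ^ (p * n + 1) * y).toList ∈ H → ∀ a b, n ≤ a → n ≤ b →
      (x * u ^ (p * a) * v * u ^ (p * b) * y).toList ∈ H

/-- The surplus copies of `u` are absorbed into `y`. -/
theorem Pumps.mono {D D' : Set (Language A)} {p n n' : ℕ} {H : Language A} (h : Pumps D p n H)
    (hD : D ⊆ D') (hn : n ≤ n') : Pumps D' p n' H := by
  intro u v huv x y hmem a b ha hb
  obtain ⟨d, rfl⟩ := Nat.exists_eq_add_of_le hn
  obtain ⟨b', rfl⟩ := Nat.exists_eq_add_of_le hb
  have key := h u v (fun K hK => huv K (hD hK)) x (u ^ (p * d) * y) (by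
    convert hmem using 2
    rw [show p * (n + d) + 1 = p * n + 1 + p * d by ring, pow_add u (p * n + 1)]
    simp only [mul_assoc]) a (n + b') (by omega) (by omega)
  convert key using 2
  rw [show p * (n + d + b') = p * (n + b') + p * d by ring, pow_add u (p * (n + b'))]
  simp only [mul_assoc]

theorem Pumps.marked {D : Set (Language A)} {p n₁ n₂ : ℕ} {H K : Language A} (hp : 0 < p) (a : A)
    (hH : Pumps D p n₁ H) (hK : Pumps D p n₂ K) :
    Pumps D p (n₁ + n₂ + 1) (H * ({[a]} : Language A) * K) := by
  intro u v huv x y hmem c d hc hd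
  obtain ⟨h, k, hh, hk, e⟩ := mem_marked_iff.1 hmem
  rw [mem_marked_iff]
  rcases mul_of_mul_eq_mul_pow_mul y _ x e with
    ⟨z, rfl, rfl⟩ | ⟨z, rfl, rfl⟩ | ⟨i, j, u₁, u₂, hij, hu, rfl, rfl⟩
  · refine ⟨h, _, hh, (hK.mono subset_rfl (by omega)) u v huv z y hk c d hc hd, ?_⟩
    simp only [mul_assoc]
  · refine ⟨_, k, (hH.mono subset_rfl (by omega)) u v huv x z hh c d hc hd, hk, ?_⟩
    simp only [mul_assoc]
  -- Apart from the copy of `u` that holds the marked letter, `p * (n₁ + n₂ + 1)` copies remain,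
  -- more than `p * n₁ + p * n₂`; so one side has enough to pump.
  · have hlarge : p * n₁ + 1 ≤ i ∨ p * n₂ + 1 ≤ j := by
      by_contra hcon
      have : i + j = p * n₁ + p * n₂ + p := by
        have : p * (n₁ + n₂ + 1) = p * n₁ + p * n₂ + p := by ring
        omega
      omega
    have hu' : ∀ z, u * z = u₁ * (FreeMonoid.of a * (u₂ * z)) := fun z => by
      conv_lhs => rw [hu]
      simp only [mul_assoc]
    rcases hlarge with hi | hj
    · obtain ⟨i, rfl⟩ := Nat.exists_eq_add_of_le hi
      obtain ⟨d, rfl⟩ := Nat.exists_eq_add_of_le hd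
      refine ⟨_, _, hH u v huv x (u ^ i * u₁) ?_ c (n₁ + d) (by omega) (by omega), hk, ?_⟩
      · convert hh using 2
        rw [pow_add u (p * n₁ + 1)]
        simp only [mul_assoc]
      -- Pumping to the right exponent `n₁ + d` makes the copies after `v` add up exactly, including
      -- the one split by the marked letter.
      · have hexp : p * (n₁ + n₂ + 1 + d) = p * (n₁ + d) + i + 1 + j := by
          have h1 : p * (n₁ + n₂ + 1 + d) = p * (n₁ + n₂ + 1) + p * d := by ring
          have h2 : p * (n₁ + d) = p * n₁ + p * d := by ring
          omega
        rw [hexp, pow_add u _ j, pow_add u _ 1, pow_add u _ i, pow_one]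
        simp only [mul_assoc]
        rw [hu' (u ^ j * y)]
    · obtain ⟨j, rfl⟩ := Nat.exists_eq_add_of_le hj
      obtain ⟨c, rfl⟩ := Nat.exists_eq_add_of_le hc
      refine ⟨_, _, hh, hK u v huv (u₂ * u ^ j) y ?_ (n₂ + c) d (by omega) (by omega), ?_⟩
      · convert hk using 2
        rw [add_comm (p * n₂ + 1), pow_add u j]
        simp only [mul_assoc]
      · have hexp : p * (n₁ + n₂ + 1 + c) = i + 1 + j + p * (n₂ + c) := by
          have h1 : p * (n₁ + n₂ + 1 + c) = p * (n₁ + n₂ + 1) + p * c := by ring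
          have h2 : p * (n₂ + c) = p * n₂ + p * c := by ring
          omega
        rw [hexp, pow_add u _ (p * (n₂ + c)), pow_add u _ j, pow_add u _ 1, pow_one]
        simp only [mul_assoc]
        rw [hu' (u ^ j * _)]

theorem pow_omega_mul {M : Type*} [Monoid M] [Finite M] (s : M) {n : ℕ} (hn : 0 < n) :
    s ^ (omega M * n) = s ^ omega M := by
  obtain ⟨n, rfl⟩ := Nat.exists_eq_succ_of_ne_zero hn.ne'
  rw [pow_mul]
  exact ((omega_spec M).2 s).pow_succ_eq n

/-- The two-sided quotients of a regular language are finitely many. -/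
theorem finite_quotients {K : Language A} (hK : K.IsRegular) :
    {U : Language A | ∃ x y, U = rightQuotient (K.leftQuotient x) y}.Finite := by
  have := finite_syntacticMonoid hK
  refine (Set.finite_range fun z : SyntacticMonoid K × SyntacticMonoid K =>
    ({w | z.1 * syntacticMorphism K (FreeMonoid.ofList w) * z.2 ∈ syntacticImage K} :
      Language A)).subset ?_
  rintro _ ⟨x, y, rfl⟩
  refine ⟨(syntacticMorphism K (FreeMonoid.ofList x), syntacticMorphism K (FreeMonoid.ofList y)), ?_⟩
  ext w
  change _ * _ * _ ∈ syntacticImage K ↔ x ++ (w ++ y) ∈ K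
  rw [← map_mul, ← map_mul, mem_syntacticImage_iff]
  simp

/-- Positive multiples of `p` as exponents give the same idempotent image in the syntactic monoid of
`K`. So `u` may be isolated between two powers, and it then lies in a quotient of `K`, which also
contains `v`. -/
theorem pumps_of_isRegular {K : Language A} (hK : K.IsRegular) {p : ℕ} (hp : 0 < p)
    (hdvd : omega (SyntacticMonoid K) ∣ p) :
    Pumps {U : Language A | ∃ x y, U = rightQuotient (K.leftQuotient x) y} p 1 K := by
  have := finite_syntacticMonoid hK
  intro u v huv x y hmem a b ha hb
  obtain ⟨c, rfl⟩ := hdvd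
  have hc : 0 < c := Nat.pos_of_mul_pos_left hp
  set o := omega (SyntacticMonoid K)
  have hu : (x * u ^ (o * c * a) * u * u ^ (o * c * b) * y).toList ∈ K := by
    rw [← mem_syntacticImage_iff] at hmem ⊢
    convert hmem using 1
    have hpow : ∀ d, 0 < d → syntacticMorphism K u ^ (o * c * d) = syntacticMorphism K u ^ o := by
      intro d hd
      rw [mul_assoc]
      exact pow_omega_mul _ (Nat.mul_pos hc hd)
    have hid := (omega_spec (SyntacticMonoid K)).2 (syntacticMorphism K u)
    have hcomm : syntacticMorphism K u ^ o * syntacticMorphism K u * syntacticMorphism K u ^ o =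
        syntacticMorphism K u ^ o * syntacticMorphism K u := by
      rw [← pow_succ, ← pow_add, show o + 1 + o = o + o + 1 by ring, pow_succ, pow_succ, pow_add,
        hid.eq]
    simp only [map_mul, map_pow, pow_succ, hpow a ha, hpow b hb, hpow 1 one_pos]
    rw [← hcomm]
    simp only [mul_assoc]
  have hv := huv _ ⟨(x * u ^ (o * c * a)).toList, (u ^ (o * c * b) * y).toList, rfl⟩ (by
    change (x * u ^ (o * c * a)).toList ++ (u.toList ++ (u ^ (o * c * b) * y).toList) ∈ K
    simpa using hu)
  change (x * u ^ (o * c * a)).toList ++ (v.toList ++ (u ^ (o * c * b) * y).toList) ∈ K at hv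
  simpa using hv

/-- Leaving `p` free among the positive multiples of `q` lets different components, and later `L`
itself, share one period. -/
theorem Pol.exists_pumps (hC : IsRegularQuotientingLattice C) {H : Language A} (hH : H ∈ Pol C) :
    ∃ D : Set (Language A), D.Finite ∧ D ⊆ C ∧ ∃ q n, 0 < q ∧ 0 < n ∧
      ∀ p, 0 < p → q ∣ p → Pumps D p n H := by
  induction hH with
  | base K hK =>
    have hreg := hC.isRegular K hK
    have := finite_syntacticMonoid hreg
    refine ⟨_, finite_quotients hreg, ?_, _, 1, (omega_spec (SyntacticMonoid K)).1, one_pos,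
      fun p hp hdvd => pumps_of_isRegular hreg hp hdvd⟩
    rintro _ ⟨x, y, rfl⟩
    exact hC.rightQuotient_mem _ (hC.leftQuotient_mem _ hK _) _
  | union H K _ _ ihH ihK =>
    obtain ⟨D, hD, hDC, q, n, hq, hn, h⟩ := ihH
    obtain ⟨D', hD', hDC', q', n', hq', hn', h'⟩ := ihK
    refine ⟨D ∪ D', hD.union hD', Set.union_subset hDC hDC', q * q', n + n',
      Nat.mul_pos hq hq', by omega, fun p hp hdvd => ?_⟩
    have h₁ := (h p hp (dvd_of_mul_right_dvd hdvd)).mono (D' := D ∪ D')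
      Set.subset_union_left (n' := n + n') (by omega)
    have h₂ := (h' p hp (dvd_of_mul_left_dvd hdvd)).mono (D' := D ∪ D')
      Set.subset_union_right (n' := n + n') (by omega)
    rintro u v huv x y (hm | hm) a b ha hb
    · exact Or.inl (h₁ u v huv x y hm a b ha hb)
    · exact Or.inr (h₂ u v huv x y hm a b ha hb)
  | marked H K a _ _ ihH ihK =>
    obtain ⟨D, hD, hDC, q, n, hq, hn, h⟩ := ihH
    obtain ⟨D', hD', hDC', q', n', hq', hn', h'⟩ := ihK
    refine ⟨D ∪ D', hD.union hD', Set.union_subset hDC hDC', q * q', n + n' + 1,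
      Nat.mul_pos hq hq', by omega, fun p hp hdvd => ?_⟩
    exact Pumps.marked hp a
      ((h p hp (dvd_of_mul_right_dvd hdvd)).mono Set.subset_union_left le_rfl)
      ((h' p hp (dvd_of_mul_left_dvd hdvd)).mono Set.subset_union_right le_rfl)

theorem Pol.pow_omega_succ_le (hC : IsRegularQuotientingLattice C) {L : Language A}
    (hL : L.IsRegular) (hP : L ∈ Pol C) {s t : SyntacticMonoid L}
    (hst : IsPair C (syntacticMorphism L) s t) :
    s ^ (omega (SyntacticMonoid L) + 1) ≤
      s ^ omega (SyntacticMonoid L) * t * s ^ omega (SyntacticMonoid L) := by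
  have := finite_syntacticMonoid hL
  obtain ⟨D, hD, hDC, q, n, hq, hn, h⟩ := Pol.exists_pumps hC hP
  obtain ⟨u, v, rfl, rfl, huv⟩ := hst.exists_words hC hD hDC
  set α := syntacticMorphism L
  set o := omega (SyntacticMonoid L)
  have ho : 0 < o := (omega_spec (SyntacticMonoid L)).1
  intro x y hxy
  obtain ⟨x, rfl⟩ := syntacticMorphism_surjective L x
  obtain ⟨y, rfl⟩ := syntacticMorphism_surjective L y
  have hpow : α u ^ (o * q * n) = α u ^ o := by
    rw [mul_assoc]
    exact pow_omega_mul _ (Nat.mul_pos hq hn)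
  -- The period `o * q` is admissible for pumping and also turns the powers into `α u ^ o`.
  have key := h (o * q) (Nat.mul_pos ho hq) (dvd_mul_left _ _) u v huv x y (by
    rw [← mem_syntacticImage_iff]
    simpa only [map_mul, map_pow, pow_succ, α, hpow] using hxy) n n le_rfl le_rfl
  rw [← mem_syntacticImage_iff] at key
  simp only [map_mul, map_pow] at key
  rw [hpow] at key
  simpa only [mul_assoc] using key

end PolClosure

theorem mainTheorem1 {A : Type*} [Finite A] (C : Set (Language A))
    (hC : PolClosure.IsRegularQuotientingLattice C) (L : Language A) (hL : L.IsRegular) :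
    List.TFAE [
      L ∈ PolClosure.Pol C,
      ∀ s t : PolClosure.SyntacticMonoid L,
        PolClosure.IsPair C (PolClosure.syntacticMorphism L) s t →
          s ^ (PolClosure.omega (PolClosure.SyntacticMonoid L) + 1) ≤
            s ^ PolClosure.omega (PolClosure.SyntacticMonoid L) * t *
              s ^ PolClosure.omega (PolClosure.SyntacticMonoid L),
      ∀ e t : PolClosure.SyntacticMonoid L, IsIdempotentElem e →
        PolClosure.IsPair C (PolClosure.syntacticMorphism L) e t → e ≤ e * t * e] := by
  have := PolClosure.finite_syntacticMonoid hL
  tfae_have 1 → 2 := fun hP s t hst => PolClosure.Pol.pow_omega_succ_le hC hL hP hst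
  tfae_have 2 → 3 := by
    intro h e t he het
    have hpos := (PolClosure.omega_spec (PolClosure.SyntacticMonoid L)).1
    have hle := h e t het
    rwa [he.pow_succ_eq, he.pow_eq hpos.ne'] at hle
  tfae_have 3 → 1 := fun h =>
    (PolClosure.factorizationClosed_polCovers hC hL h).univ.mem_pol hC
  tfae_finish
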